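/- Let $\mathbb H$ be the quaternions, $\mathbb S=\{I\in\mathbb H: I^2=-1\}$ and $\mathbb C_I=\mathbb R+\mathbb R I$ for $I\in\mathbb S$. Let $D\subseteq\mathbb C$ be open with $\overline D=D$ and let $\Omega_D=\{\alpha+I\beta: \alpha+i\beta\in D,\ I\in\mathbb S\}$. A stem function is a map $F=F_0+\sqrt{-1}\,F_1:D\to\mathbb H\otimes\mathbb C$ ($F_0,F_1$ being $\mathbb H$-valued) with $F(\bar z)=\overline{F(z)}$, where $\overline{x+\sqrt{-1}\,y}=x-\sqrt{-1}\,y$; it induces the slice function $f(\alpha+I\beta)=F_0(\alpha+i\beta)+I\,F_1(\alpha+i\beta)$ on $\Omega_D$. A function $f:\Omega_D\to\mathbb H$ is slice regular if it is induced by a holomorphic stem function; a slice function is slice preserving if $F_0,F_1$ are real valued, and, for $J\in\mathbb S$, it is $\mathbb C_J$-preserving if $F_0,F_1$ are $\mathbb C_J$-valued. For $q_0\in\Omega_D\setminus\mathbb R$ put $\Delta_{q_0}(x)=x^2-2\,\mathrm{Re}(q_0)\,x+|q_0|^2$. The spherical coefficients $(s_n(q_0))_{n\ge 0}\subset\mathbb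 H$ of a slice regular $f$ at $q_0$ are the coefficients in the spherical expansion $$f(x)=\sum_{n\ge 0}\Delta_{q_0}(x)^n\,[\,s_{2n}(q_0)+(x-q_0)\,s_{2n+1}(q_0)\,],$$ valid on some Cassini ball $\{x\in\mathbb H: |\Delta_{q_0}(x)|<R^2\}\subseteq\Omega_D$ with $R>0$. Let $f:\Omega_D\to\mathbb H$ be slice regular. Then, at every $q_0\in\Omega_D\setminus\mathbb R$, the spherical coefficients exist and are unique, and the following hold. 1. $f$ is slice preserving if and only if, for every $q_0\in\Omega_D\setminus\mathbb R$ and every $k\in\mathbb N$, $s_{2k+1}(q_0)\in\mathbb R$ and, for $I\in\mathbb S$ with $q_0\in\mathbb C_I$, $s_{2k}(q_0)\in\mathbb C_I$. 2. Let $J\in\mathbb S$. Then $f$ is $\mathbb C_J$-preserving if and only if, for every $q_0\in\Omega_D\setminus\mathbb R$ and every $k\in\mathbb N$, $s_{2k+1}(q_0)\in\mathbb C_J$ and, if $q_0\in\mathbb C_J$, $s_{2k}(q_0)\in\mathbb C_J$. If moreover $\Omega_D$ is connected, then for any single fixed $q_0\in(\Omega_D\cap\mathbb C_J)\setminus\mathbb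 R$, $f$ is $\mathbb C_J$-preserving if and only if $s_n(q_0)\in\mathbb C_J$ for all $n\in\mathbb N$. -/

import Mathlib

open scoped Quaternion

namespace SliceRegular

/-- The sphere of imaginary units of the quaternions. -/
def imagUnits : Set ℍ[ℝ] := {I | I ^ 2 = -1}

/-- The complex plane `ℂ_I = {α + β I | α β : ℝ}` spanned by `1` and `I`. -/
def slicePlane (I : ℍ[ℝ]) : Set ℍ[ℝ] := {q | ∃ α β : ℝ, q = (α : ℍ[ℝ]) + (β : ℍ[ℝ]) * I}

/-- The real line inside the quaternions. -/
def realLine : Set ℍ[ℝ] := Set.range (fun r : ℝ => (r : ℍ[ℝ]))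

/-- The circularization `Ω_D` of a set `D` of complex numbers. -/
def circularization (D : Set ℂ) : Set ℍ[ℝ] :=
  {q | ∃ α β : ℝ, ∃ I ∈ imagUnits, (⟨α, β⟩ : ℂ) ∈ D ∧ q = (α : ℍ[ℝ]) + I * (β : ℍ[ℝ])}

/-- Multiplication by `√-1` on `ℍ ⊗ ℂ`, whose element `x + √-1 y` is written as the pair
`(x, y)`. -/
def mulSqrtNegOne (w : ℍ[ℝ] × ℍ[ℝ]) : ℍ[ℝ] × ℍ[ℝ] := (-w.2, w.1)

/-- `F = F₀ + √-1 F₁ : D → ℍ ⊗ ℂ` is a stem function: `F (conj z) = conj (F z)`, where the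
conjugate of `x + √-1 y` is `x - √-1 y`. -/
def IsStemFunction (D : Set ℂ) (F : ℂ → ℍ[ℝ] × ℍ[ℝ]) : Prop :=
  ∀ z ∈ D, F (starRingEnd ℂ z) = ((F z).1, -(F z).2)

/-- `F` induces the (left) slice function `f` on `Ω_D`:
`f (α + I β) = F₀ (α + i β) + I F₁ (α + i β)`. -/
def Induces (D : Set ℂ) (F : ℂ → ℍ[ℝ] × ℍ[ℝ]) (f : ℍ[ℝ] → ℍ[ℝ]) : Prop :=
  ∀ α β : ℝ, (⟨α, β⟩ : ℂ) ∈ D → ∀ I ∈ imagUnits,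
    f ((α : ℍ[ℝ]) + I * (β : ℍ[ℝ])) = (F ⟨α, β⟩).1 + I * (F ⟨α, β⟩).2

/-- `F : D → ℍ ⊗ ℂ` is holomorphic for the complex structure of `ℍ ⊗ ℂ`: at every point of `D`
its real differential exists and is complex linear. -/
def IsHolomorphic (D : Set ℂ) (F : ℂ → ℍ[ℝ] × ℍ[ℝ]) : Prop :=
  ∀ z ∈ D, ∃ L : ℂ →L[ℝ] ℍ[ℝ] × ℍ[ℝ],
    HasFDerivAt F L z ∧ ∀ v : ℂ, L (Complex.I * v) = mulSqrtNegOne (L v)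

/-- `f` is slice regular on `Ω_D`: it is induced by a holomorphic stem function. -/
def IsSliceRegular (D : Set ℂ) (f : ℍ[ℝ] → ℍ[ℝ]) : Prop :=
  ∃ F : ℂ → ℍ[ℝ] × ℍ[ℝ], IsStemFunction D F ∧ IsHolomorphic D F ∧ Induces D F f

/-- `f` is slice preserving on `Ω_D`: it is induced by a stem function with real components. -/
def IsSlicePreserving (D : Set ℂ) (f : ℍ[ℝ] → ℍ[ℝ]) : Prop :=
  ∃ F : ℂ → ℍ[ℝ] × ℍ[ℝ], IsStemFunction D F ∧ Induces D F f ∧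
    ∀ z ∈ D, (F z).1 ∈ realLine ∧ (F z).2 ∈ realLine

/-- `f` is `ℂ_J`-preserving on `Ω_D`: it is induced by a stem function with components
in `ℂ_J`. -/
def IsOneSlicePreserving (D : Set ℂ) (J : ℍ[ℝ]) (f : ℍ[ℝ] → ℍ[ℝ]) : Prop :=
  ∃ F : ℂ → ℍ[ℝ] × ℍ[ℝ], IsStemFunction D F ∧ Induces D F f ∧
    ∀ z ∈ D, (F z).1 ∈ slicePlane J ∧ (F z).2 ∈ slicePlane J

/-- The characteristic polynomial
`Δ_{q₀}(x) = x² - x (q₀ + q₀ᶜ) + q₀ q₀ᶜ = x² - 2 Re(q₀) x + |q₀|²`. -/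
noncomputable def charPoly (q₀ x : ℍ[ℝ]) : ℍ[ℝ] := x ^ 2 - x * (q₀ + star q₀) + q₀ * star q₀

/-- The Cassini ball `U(q₀, R)`. -/
def cassiniBall (q₀ : ℍ[ℝ]) (R : ℝ) : Set ℍ[ℝ] := {x | ‖charPoly q₀ x‖ < R ^ 2}

/-- `f(x) = ∑ₙ Δ_{q₀}(x)ⁿ [s₂ₙ + (x - q₀) s₂ₙ₊₁]` on some Cassini ball contained in `Ω_D`. -/
def HasSphericalExpansion (D : Set ℂ) (f : ℍ[ℝ] → ℍ[ℝ]) (q₀ : ℍ[ℝ]) (s : ℕ → ℍ[ℝ]) : Prop :=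
  ∃ R : ℝ, 0 < R ∧ cassiniBall q₀ R ⊆ circularization D ∧
    ∀ x ∈ cassiniBall q₀ R,
      HasSum (fun n : ℕ => charPoly q₀ x ^ n * (s (2 * n) + (x - q₀) * s (2 * n + 1))) (f x)

open Classical in
/-- The spherical coefficients `s_n(q₀)` of `f` at `q₀` (the zero sequence if there is no
spherical expansion at `q₀`). -/
noncomputable def sphericalCoeff (D : Set ℂ) (f : ℍ[ℝ] → ℍ[ℝ]) (q₀ : ℍ[ℝ]) : ℕ → ℍ[ℝ] :=
  if h : ∃ s, HasSphericalExpansion D f q₀ s then h.choose else 0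

end SliceRegular

open SliceRegular

/-! ### Slices of the quaternions as copies of `ℂ` -/

namespace SliceRegular

/-! Write `q₀ = α + I₀β`. On every slice `ℂ_I`, `Δ_{q₀}` is the real polynomial `w = (z - α)² + β²`,
so the expansion is a statement about complex functions.

Existence: a holomorphic `g` on `D` commuting with conjugation splits about `α` into even and odd
parts, `g(z) = E(w) + (z - α) O(w)`. Both `E` and `O` are holomorphic near `w = 0` with real Taylor
coefficients (`exists_scalar_expansion`). Applying this to the real coordinates of the stem function
and embedding in each slice gives an expansion in `x - α`, which is then recentred at `q₀`.

Converse direction: at the two points `α ± I₀y` with `Δ_{q₀} = t` real, `y = √(β² - t)`, the sum and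
difference of the expansions give `F₀ = ∑ tⁿ (s₂ₙ - β I₀ s₂ₙ₊₁)` and `F₁ / y = ∑ tⁿ s₂ₙ₊₁`
(`HasSphericalExpansion.hasSum_stem`). Uniqueness is then uniqueness of real power series. Since
`ℂ_J` is a closed real subspace (the centralizer of `J`), membership in it passes from stem values
to coefficients and back.

For the criterion over all `q₀`, the terms at `t = 0` recover `F` off the real axis, and continuity
does the rest. For a single `q₀`, `F` is `ℂ_J`-valued on a vertical segment, and the identity
theorem spreads this over `D`. Slice preserving means `ℂ_J`-preserving for every `J`, because the
slices intersect in `ℝ`. -/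

theorem imagUnits_mul_self {I : ℍ[ℝ]} (hI : I ∈ imagUnits) : I * I = -1 := by
  rw [← sq]; exact hI

theorem neg_mem_imagUnits {I : ℍ[ℝ]} (hI : I ∈ imagUnits) : -I ∈ imagUnits := by
  simpa [imagUnits] using hI

theorem imagUnits_components {I : ℍ[ℝ]} (hI : I ∈ imagUnits) :
    I.re = 0 ∧ I.imI ^ 2 + I.imJ ^ 2 + I.imK ^ 2 = 1 := by
  have h := imagUnits_mul_self hI
  have h0 := congrArg QuaternionAlgebra.re h
  have h1 := congrArg QuaternionAlgebra.imI h
  have h2 := congrArg QuaternionAlgebra.imJ h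
  have h3 := congrArg QuaternionAlgebra.imK h
  simp at h0 h1 h2 h3
  have hre : I.re = 0 := by
    by_contra hne
    have e1 : I.imI = 0 := by
      apply mul_left_cancel₀ hne; linarith
    have e2 : I.imJ = 0 := by
      apply mul_left_cancel₀ hne; linarith
    have e3 : I.imK = 0 := by
      apply mul_left_cancel₀ hne; linarith
    rw [e1, e2, e3] at h0
    nlinarith [sq_nonneg I.re]
  refine ⟨hre, ?_⟩
  rw [hre] at h0
  linarith

theorem mem_imagUnits_of_components {I : ℍ[ℝ]} (h₀ : I.re = 0)
    (h₁ : I.imI ^ 2 + I.imJ ^ 2 + I.imK ^ 2 = 1) : I ∈ imagUnits := by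
  change I ^ 2 = -1
  rw [sq]
  ext <;> simp [h₀]
  · linarith
  · ring
  · ring
  · ring

theorem imagUnits_nonempty : imagUnits.Nonempty :=
  ⟨⟨0, 1, 0, 0⟩, mem_imagUnits_of_components rfl (by simp)⟩

/-- The embedding of `ℂ` onto the slice `ℂ_I`. -/
noncomputable def sliceEmb {I : ℍ[ℝ]} (hI : I ∈ imagUnits) : ℂ →ₐ[ℝ] ℍ[ℝ] :=
  Complex.lift ⟨I, imagUnits_mul_self hI⟩

variable {I : ℍ[ℝ]} (hI : I ∈ imagUnits)

theorem sliceEmb_apply (z : ℂ) : sliceEmb hI z = (z.re : ℍ[ℝ]) + I * (z.im : ℍ[ℝ]) := by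
  rw [sliceEmb, Complex.lift_apply, Complex.liftAux_apply]
  congr 1
  rw [Quaternion.mul_coe_eq_smul]

theorem sliceEmb_ofReal (r : ℝ) : sliceEmb hI (r : ℂ) = (r : ℍ[ℝ]) := by
  simp

theorem continuous_sliceEmb : Continuous (sliceEmb hI) :=
  (sliceEmb hI).toLinearMap.continuous_of_finiteDimensional

theorem norm_sliceEmb (z : ℂ) : ‖sliceEmb hI z‖ = ‖z‖ := by
  have h : ‖sliceEmb hI z‖ ^ 2 = ‖z‖ ^ 2 := by
    rw [Complex.sq_norm, Complex.normSq_apply, sq, ← Quaternion.normSq_eq_norm_mul_self,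
      Quaternion.normSq_def', sliceEmb_apply]
    have h := imagUnits_components hI
    simp [h.1]
    linear_combination z.im ^ 2 * h.2
  exact (pow_left_inj₀ (norm_nonneg _) (norm_nonneg _) two_ne_zero).1 h

/-- The value at `z` of the real quadratic polynomial with roots `z₀` and its conjugate. -/
noncomputable def quadPoly (z₀ z : ℂ) : ℂ := (z - z₀.re) ^ 2 + z₀.im ^ 2

theorem quadPoly_eq_mul (z₀ z : ℂ) : quadPoly z₀ z = (z - z₀) * (z - starRingEnd ℂ z₀) := by
  rw [quadPoly]
  apply Complex.ext <;> simp [sq] <;> ring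

/-- Only the trace and norm of the centre enter `charPoly`, and they are real; hence the centre and
the variable may lie in different slices. -/
theorem charPoly_sliceEmb {I₀ : ℍ[ℝ]} (hI₀ : I₀ ∈ imagUnits) (z₀ z : ℂ) :
    charPoly (sliceEmb hI₀ z₀) (sliceEmb hI z) = sliceEmb hI (quadPoly z₀ z) := by
  have h1 : sliceEmb hI₀ z₀ + star (sliceEmb hI₀ z₀) = sliceEmb hI ((2 * z₀.re : ℝ) : ℂ) := by
    rw [Quaternion.self_add_star', sliceEmb_ofReal]
    simp [sliceEmb_apply, (imagUnits_components hI₀).1]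
  have h2 : sliceEmb hI₀ z₀ * star (sliceEmb hI₀ z₀) =
      sliceEmb hI ((z₀.re ^ 2 + z₀.im ^ 2 : ℝ) : ℂ) := by
    rw [Quaternion.self_mul_star, Quaternion.normSq_eq_norm_mul_self, norm_sliceEmb,
      sliceEmb_ofReal, ← sq, Complex.sq_norm, Complex.normSq_apply]
    congr 1; ring
  rw [charPoly, h1, h2, ← map_pow, ← map_mul, ← map_sub, ← map_add, quadPoly]
  congr 1
  push_cast; ring

theorem exists_sliceEmb_eq (x : ℍ[ℝ]) :
    ∃ (I : ℍ[ℝ]) (hI : I ∈ imagUnits) (z : ℂ), x = sliceEmb hI z := by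
  by_cases h : x.im = 0
  · obtain ⟨I, hI⟩ := imagUnits_nonempty
    refine ⟨I, hI, (x.re : ℂ), ?_⟩
    rw [sliceEmb_ofReal, ← Quaternion.re_add_im x, h]; simp
  · have hn : ‖x.im‖ ≠ 0 := norm_ne_zero_iff.2 h
    have hI : (‖x.im‖⁻¹ • x.im) ∈ imagUnits := by
      have : x.im * x.im = -((‖x.im‖ * ‖x.im‖ : ℝ) : ℍ[ℝ]) := by
        rw [← Quaternion.normSq_eq_norm_mul_self, ← sq, Quaternion.sq_eq_neg_normSq.2 (by simp)]
      simp only [imagUnits, Set.mem_ofPred_eq, sq, smul_mul_smul_comm, this]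
      rw [smul_neg, Quaternion.smul_coe]
      congr 1
      rw [← Quaternion.coe_one]; congr 1; field_simp
    refine ⟨_, hI, ⟨x.re, ‖x.im‖⟩, ?_⟩
    rw [sliceEmb_apply, Quaternion.mul_coe_eq_smul, smul_smul, mul_inv_cancel₀ hn, one_smul,
      Quaternion.re_add_im]

/-- The half-plane coordinate of a quaternion. -/
noncomputable def halfPlaneCoord (x : ℍ[ℝ]) : ℂ := ⟨x.re, ‖x.im‖⟩

theorem continuous_halfPlaneCoord : Continuous halfPlaneCoord := by
  have : halfPlaneCoord = fun x => ((x.re : ℂ) + ((‖x.im‖ : ℝ) : ℂ) * Complex.I) := by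
    funext x
    apply Complex.ext <;> simp [halfPlaneCoord]
  rw [this]
  have h1 : Continuous fun x : ℍ[ℝ] => x.re := Quaternion.continuous_re
  have h2 : Continuous fun x : ℍ[ℝ] => x.im := Quaternion.continuous_im
  fun_prop

theorem halfPlaneCoord_sliceEmb (z : ℂ) : halfPlaneCoord (sliceEmb hI z) = ⟨z.re, |z.im|⟩ := by
  have h := (imagUnits_components hI).1
  have e : (sliceEmb hI z).im = sliceEmb hI ⟨0, z.im⟩ := by
    simp only [sliceEmb_apply]
    ext <;> simp [h]
  apply Complex.ext
  · simp [halfPlaneCoord, sliceEmb_apply, h]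
  · simp only [halfPlaneCoord]
    rw [e, norm_sliceEmb]
    have : (⟨0, z.im⟩ : ℂ) = (z.im : ℂ) * Complex.I := by apply Complex.ext <;> simp
    rw [this]; simp

theorem mem_or_conj_mem {D : Set ℂ} (hDs : ∀ z ∈ D, starRingEnd ℂ z ∈ D) (z : ℂ) :
    (⟨z.re, |z.im|⟩ : ℂ) ∈ D ↔ z ∈ D := by
  rcases abs_cases z.im with h | h
  · rw [h.1]
  · have e : (⟨z.re, |z.im|⟩ : ℂ) = starRingEnd ℂ z := by
      apply Complex.ext <;> simp [h.1]
    rw [e]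
    exact ⟨fun h => by simpa using hDs _ h, hDs _⟩

theorem mem_circularization_iff {D : Set ℂ} (hDs : ∀ z ∈ D, starRingEnd ℂ z ∈ D) (x : ℍ[ℝ]) :
    x ∈ circularization D ↔ halfPlaneCoord x ∈ D := by
  constructor
  · rintro ⟨α, β, I, hI, hz, rfl⟩
    have := sliceEmb_apply hI ⟨α, β⟩
    rw [← this, halfPlaneCoord_sliceEmb]
    exact (mem_or_conj_mem hDs _).2 hz
  · intro h
    obtain ⟨I, hI, z, rfl⟩ := exists_sliceEmb_eq x
    rw [halfPlaneCoord_sliceEmb, mem_or_conj_mem hDs] at h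
    exact ⟨z.re, z.im, I, hI, h, sliceEmb_apply hI z⟩

theorem sliceEmb_mem_circularization {D : Set ℂ} (hDs : ∀ z ∈ D, starRingEnd ℂ z ∈ D) (z : ℂ) :
    sliceEmb hI z ∈ circularization D ↔ z ∈ D := by
  rw [mem_circularization_iff hDs, halfPlaneCoord_sliceEmb, mem_or_conj_mem hDs]

theorem exists_quadPoly_ball_subset {D : Set ℂ} (hDo : IsOpen D)
    (hDs : ∀ z ∈ D, starRingEnd ℂ z ∈ D) {z₀ : ℂ} (hz₀ : z₀ ∈ D) (him : z₀.im ≠ 0) :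
    ∃ R : ℝ, 0 < R ∧ R ≤ |z₀.im| ∧ ∀ z, ‖quadPoly z₀ z‖ < R ^ 2 → z ∈ D := by
  obtain ⟨ε, hε, hb⟩ := Metric.isOpen_iff.1 hDo z₀ hz₀
  -- The bound by `|z₀.im|` later provides a branch of the square root. If a product of two factors
  -- is below `R²`, one factor is below `R`, so `z` is near `z₀` or its conjugate.
  refine ⟨min ε |z₀.im|, lt_min hε (abs_pos.2 him), min_le_right _ _, fun z hz => ?_⟩
  set R := min ε |z₀.im| with hR
  have hRp : 0 < R := lt_min hε (abs_pos.2 him)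
  rw [quadPoly_eq_mul, norm_mul, sq] at hz
  by_cases h : ‖z - z₀‖ < R
  · exact hb (mem_ball_iff_norm.2 (h.trans_le (min_le_left _ _)))
  · have h2 : ‖z - starRingEnd ℂ z₀‖ < R := by
      by_contra h2
      exact absurd hz (not_lt.2 (mul_le_mul (not_lt.1 h) (not_lt.1 h2) hRp.le (norm_nonneg _)))
    have h3 : starRingEnd ℂ z ∈ D := by
      apply hb
      rw [mem_ball_iff_norm]
      have : starRingEnd ℂ z - z₀ = starRingEnd ℂ (z - starRingEnd ℂ z₀) := by simp
      rw [this, RCLike.norm_conj]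
      exact h2.trans_le (min_le_left _ _)
    simpa using hDs _ h3

end SliceRegular

/-! ### Complex analysis: powers of a real quadratic, and an identity theorem -/

namespace SliceRegular

/-- Averaging the Taylor series at `w` with the conjugate of the series at the conjugate of `w`
replaces each coefficient by its real part. -/
theorem exists_real_powerSeries {h : ℂ → ℂ} {r : ℝ}
    (hd : DifferentiableOn ℂ h (Metric.ball 0 r))
    (hc : ∀ w ∈ Metric.ball (0 : ℂ) r, h (starRingEnd ℂ w) = starRingEnd ℂ (h w)) :
    ∃ e : ℕ → ℝ, ∀ w ∈ Metric.ball (0 : ℂ) r, HasSum (fun n => w ^ n * (e n : ℂ)) (h w) := by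
  have key : ∃ c : ℕ → ℂ, ∀ w ∈ Metric.ball (0 : ℂ) r, HasSum (fun n => w ^ n * c n) (h w) := by
    refine ⟨fun n => (n.factorial : ℂ)⁻¹ * iteratedDeriv n h 0, fun w hw => ?_⟩
    have hsum := Complex.hasSum_taylorSeries_on_ball hd hw
    have hterm : (fun n : ℕ => w ^ n * ((n.factorial : ℂ)⁻¹ * iteratedDeriv n h 0)) =
        fun n => (n.factorial : ℂ)⁻¹ • (w - 0) ^ n • iteratedDeriv n h 0 := by
      funext n
      simp only [smul_eq_mul, sub_zero]; ring
    rw [hterm]; exact hsum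
  obtain ⟨c, hs⟩ := key
  refine ⟨fun n => (c n).re, fun w hw => ?_⟩
  have hw' : starRingEnd ℂ w ∈ Metric.ball (0 : ℂ) r := by simpa using hw
  have h1 := (Complex.hasSum_conj' ).2 (hs _ hw')
  rw [hc w hw, Complex.conj_conj] at h1
  have hsum := ((hs w hw).add h1).mul_left (1 / 2 : ℂ)
  have hterm : (fun n : ℕ => w ^ n * (((c n).re : ℝ) : ℂ)) = fun n =>
      1 / 2 * (w ^ n * c n + starRingEnd ℂ (starRingEnd ℂ w ^ n * c n)) := by
    funext n
    simp only [map_mul, map_pow, Complex.conj_conj, Complex.re_eq_add_conj]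
    ring
  have hval : h w = 1 / 2 * (h w + h w) := by ring
  rw [hterm, hval]; exact hsum

/-- Even and odd parts about `Re z₀` are functions of `w = quadPoly z₀ z` alone: changing the sign
of the square root `v` of `w - (Im z₀)²` changes neither `(g(a+v) + g(a-v))/2` nor `(g(a+v) -
g(a-v))/(2v)`. -/
theorem exists_scalar_expansion {D : Set ℂ} {g : ℂ → ℂ}
    (hg : DifferentiableOn ℂ g D)
    (hgc : ∀ z ∈ D, g (starRingEnd ℂ z) = starRingEnd ℂ (g z)) {z₀ : ℂ} {R : ℝ}
    (hR : 0 < R) (hRi : R ≤ |z₀.im|) (hRD : ∀ z, ‖quadPoly z₀ z‖ < R ^ 2 → z ∈ D) :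
    ∃ e o : ℕ → ℝ, ∀ z, ‖quadPoly z₀ z‖ < R ^ 2 →
      HasSum (fun n => quadPoly z₀ z ^ n * ((e n : ℂ) + (z - z₀.re) * (o n : ℂ))) (g z) := by
  set a : ℂ := (z₀.re : ℂ) with ha
  set u : ℂ → ℂ := fun w => Complex.I * ((z₀.im : ℂ) ^ 2 - w) ^ (2⁻¹ : ℂ) with hu
  -- Since `R ≤ |Im z₀|`, `(Im z₀)² - w` has positive real part, so the principal root is
  -- holomorphic and nonzero.
  have hball : ∀ w ∈ Metric.ball (0 : ℂ) (R ^ 2), (z₀.im : ℂ) ^ 2 - w ∈ Complex.slitPlane := by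
    intro w hw
    left
    have h1 : w.re < R ^ 2 := (Complex.re_le_norm w).trans_lt (by simpa using hw)
    have h2 : R ^ 2 ≤ z₀.im ^ 2 := by
      rw [← sq_abs z₀.im]; gcongr
    rw [← Complex.ofReal_pow, Complex.sub_re, Complex.ofReal_re]
    linarith
  have husq : ∀ w, u w ^ 2 = w - (z₀.im : ℂ) ^ 2 := by
    intro w
    simp only [hu, mul_pow, Complex.I_sq]
    rw [Complex.cpow_ofNat_inv_pow]; ring
  have hune : ∀ w ∈ Metric.ball (0 : ℂ) (R ^ 2), u w ≠ 0 := by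
    intro w hw h0
    have := husq w
    rw [h0] at this
    apply Complex.slitPlane_ne_zero (hball w hw)
    linear_combination this
  have hud : DifferentiableOn ℂ u (Metric.ball 0 (R ^ 2)) := by
    intro w hw
    apply DifferentiableAt.differentiableWithinAt
    apply DifferentiableAt.const_mul
    exact DifferentiableAt.cpow_const (by fun_prop) (hball w hw)
  have hmem : ∀ w ∈ Metric.ball (0 : ℂ) (R ^ 2), ∀ v, v ^ 2 = w - (z₀.im : ℂ) ^ 2 → a + v ∈ D := by
    intro w hw v hv
    apply hRD
    have : quadPoly z₀ (a + v) = w := by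
      rw [quadPoly, ← ha]; linear_combination hv
    rw [this]; simpa using hw
  have husq' : ∀ w, (-u w) ^ 2 = w - (z₀.im : ℂ) ^ 2 := fun w => by rw [neg_sq, husq]
  set E : ℂ → ℂ := fun w => (g (a + u w) + g (a - u w)) / 2 with hE
  set O : ℂ → ℂ := fun w => (g (a + u w) - g (a - u w)) / (2 * u w) with hO
  -- Independence of the root is needed for two roots other than `u w`: the conjugate of `u w`,
  -- giving the symmetry of `E` and `O`, and `z - a`, giving the final formula.
  have hEv : ∀ w v, v ^ 2 = w - (z₀.im : ℂ) ^ 2 → E w = (g (a + v) + g (a - v)) / 2 := by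
    intro w v hv
    rcases sq_eq_sq_iff_eq_or_eq_neg.1 (hv.trans (husq w).symm) with h | h
    · rw [h]
    · rw [h, hE]; simp only [sub_neg_eq_add, ← sub_eq_add_neg]; ring
  have hOv : ∀ w v, v ^ 2 = w - (z₀.im : ℂ) ^ 2 → O w = (g (a + v) - g (a - v)) / (2 * v) := by
    intro w v hv
    rcases sq_eq_sq_iff_eq_or_eq_neg.1 (hv.trans (husq w).symm) with h | h
    · rw [h]
    · rw [h, hO]; simp only [sub_neg_eq_add, ← sub_eq_add_neg, mul_neg, div_neg]; ring
  have hconj : ∀ w, (starRingEnd ℂ (u w)) ^ 2 = starRingEnd ℂ w - (z₀.im : ℂ) ^ 2 := by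
    intro w
    rw [← map_pow, husq]; simp
  have hac : starRingEnd ℂ a = a := Complex.conj_ofReal _
  have hgp : ∀ w ∈ Metric.ball (0 : ℂ) (R ^ 2),
      g (a + starRingEnd ℂ (u w)) = starRingEnd ℂ (g (a + u w)) := by
    intro w hw
    rw [← hgc _ (hmem w hw _ (husq w)), map_add, hac]
  have hgm : ∀ w ∈ Metric.ball (0 : ℂ) (R ^ 2),
      g (a - starRingEnd ℂ (u w)) = starRingEnd ℂ (g (a - u w)) := by
    intro w hw
    have := hmem w hw _ (husq' w)
    rw [← sub_eq_add_neg] at this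
    rw [← hgc _ this, map_sub, hac]
  have hdp : DifferentiableOn ℂ (fun w => g (a + u w)) (Metric.ball 0 (R ^ 2)) :=
    hg.comp (hud.const_add a) fun w hw => hmem w hw _ (husq w)
  have hdm : DifferentiableOn ℂ (fun w => g (a - u w)) (Metric.ball 0 (R ^ 2)) :=
    hg.comp (hud.const_sub a) fun w hw => by
      have := hmem w hw _ (husq' w)
      rwa [← sub_eq_add_neg] at this
  obtain ⟨e, he⟩ := exists_real_powerSeries (h := E) (r := R ^ 2)
    ((hdp.add hdm).div_const 2) fun w hw => by
      rw [hEv _ _ (hconj w), hgp w hw, hgm w hw]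
      simp [hE, map_ofNat]
  obtain ⟨o, ho⟩ := exists_real_powerSeries (h := O) (r := R ^ 2)
    ((hdp.sub hdm).div (hud.const_mul 2) fun w hw => mul_ne_zero two_ne_zero (hune w hw))
    fun w hw => by
      rw [hOv _ _ (hconj w), hgp w hw, hgm w hw]
      simp [hO, map_ofNat]
  refine ⟨e, o, fun z hz => ?_⟩
  have hw : quadPoly z₀ z ∈ Metric.ball (0 : ℂ) (R ^ 2) := by simpa using hz
  have hv : (z - a) ^ 2 = quadPoly z₀ z - (z₀.im : ℂ) ^ 2 := by
    rw [quadPoly, ← ha]; ring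
  have hvne : z - a ≠ 0 := by
    intro h0
    rw [h0] at hv
    apply Complex.slitPlane_ne_zero (hball _ hw)
    linear_combination hv
  have hsum : g z = E (quadPoly z₀ z) + (z - a) * O (quadPoly z₀ z) := by
    rw [hEv _ _ hv, hOv _ _ hv, add_sub_cancel]
    field_simp; ring
  rw [hsum]
  convert (he _ hw).add ((ho _ hw).mul_left (z - a)) using 2 with n
  ring

theorem coeff_eq_zero_of_hasSum_zero {E : Type*} [NormedAddCommGroup E] [NormedSpace ℝ E]
    {c : ℕ → E} {r : ℝ} (hr : 0 < r)
    (h : ∀ t : ℝ, |t| < r → HasSum (fun n => t ^ n • c n) 0) : c = 0 := by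
  let p : FormalMultilinearSeries ℝ ℝ E :=
    fun n => ContinuousMultilinearMap.mkPiRing ℝ (Fin n) (c n)
  have hp : ∀ n, p.coeff n = c n := fun n => by simp [p, FormalMultilinearSeries.coeff]
  have : HasFPowerSeriesAt (0 : ℝ → E) p 0 := by
    rw [hasFPowerSeriesAt_iff]
    filter_upwards [Metric.ball_mem_nhds (0 : ℝ) hr] with t ht
    simpa [hp] using h t (by simpa using ht)
  have h0 := this.eq_zero
  funext n
  rw [← hp, h0]; simp [FormalMultilinearSeries.coeff]

/-- `D` may be disconnected even when `Ω_D` is connected, as `D` may miss the real axis. The usual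
open partition of `D` is therefore pulled back to `Ω_D` by `halfPlaneCoord`, which reaches only the
closed upper half of `D`; conjugation symmetry covers the lower half. -/
theorem eqOn_zero_of_isPreconnected_circularization {D : Set ℂ} (hDo : IsOpen D)
    (hDs : ∀ z ∈ D, starRingEnd ℂ z ∈ D) (hconn : IsPreconnected (circularization D)) {g : ℂ → ℂ}
    (hg : DifferentiableOn ℂ g D)
    (hgc : ∀ z ∈ D, g (starRingEnd ℂ z) = starRingEnd ℂ (g z)) {z₀ : ℂ} (hz₀ : z₀ ∈ D)
    (him : 0 ≤ z₀.im) (hfreq : ∃ᶠ z in nhdsWithin z₀ {z₀}ᶜ, g z = 0) :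
    ∀ z ∈ D, g z = 0 := by
  have han : ∀ z ∈ D, AnalyticAt ℂ g z := fun z hz => hg.analyticAt (hDo.mem_nhds hz)
  set A : Set ℂ := {z | z ∈ D ∧ ∀ᶠ w in nhds z, g w = 0} with hA
  set B : Set ℂ := {z | z ∈ D ∧ ¬ ∀ᶠ w in nhds z, g w = 0} with hB
  have hAo : IsOpen A := by
    rw [isOpen_iff_mem_nhds]
    rintro z ⟨hz, h⟩
    filter_upwards [hDo.mem_nhds hz, h.eventually_nhds] with w h1 h2 using ⟨h1, h2⟩
  have hBo : IsOpen B := by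
    rw [isOpen_iff_mem_nhds]
    rintro z ⟨hz, h⟩
    have h1 := ((han z hz).eventually_eq_zero_or_eventually_ne_zero).resolve_left h
    rw [eventually_nhdsWithin_iff] at h1
    filter_upwards [hDo.mem_nhds hz, h1] with w h2 h3
    refine ⟨h2, fun h4 => ?_⟩
    by_cases hwz : w = z
    · exact h (hwz ▸ h4)
    · exact h3 hwz h4.self_of_nhds
  obtain ⟨I, hI⟩ := imagUnits_nonempty
  have hhalf : ∀ z : ℂ, 0 ≤ z.im → halfPlaneCoord (sliceEmb hI z) = z := fun z hz => by
    rw [halfPlaneCoord_sliceEmb, abs_of_nonneg hz]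
  have hz₀A : z₀ ∈ A := ⟨hz₀, (han z₀ hz₀).frequently_zero_iff_eventually_zero.1 hfreq⟩
  have hmain : ∀ z ∈ D, 0 ≤ z.im → g z = 0 := by
    intro z hz hzi
    by_contra hne
    have hzB : z ∈ B := ⟨hz, fun h => hne h.self_of_nhds⟩
    obtain ⟨x, -, hx1, hx2⟩ := hconn _ _ (hAo.preimage continuous_halfPlaneCoord)
      (hBo.preimage continuous_halfPlaneCoord)
      (fun x hx => by
        rw [mem_circularization_iff hDs] at hx
        by_cases h : ∀ᶠ w in nhds (halfPlaneCoord x), g w = 0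
        · exact Or.inl ⟨hx, h⟩
        · exact Or.inr ⟨hx, h⟩)
      ⟨sliceEmb hI z₀, (sliceEmb_mem_circularization hI hDs _).2 hz₀, by
        rw [Set.mem_preimage, hhalf z₀ him]; exact hz₀A⟩
      ⟨sliceEmb hI z, (sliceEmb_mem_circularization hI hDs _).2 hz, by
        rw [Set.mem_preimage, hhalf z hzi]; exact hzB⟩
    exact hx2.2 hx1.2
  intro z hz
  rcases le_total 0 z.im with h | h
  · exact hmain z hz h
  · have := hmain _ (hDs z hz) (by simpa using h)
    rw [hgc z hz] at this
    simpa using this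

end SliceRegular

/-! ### Spherical expansions: existence and uniqueness -/

namespace SliceRegular

variable {D : Set ℂ} {F : ℂ → ℍ[ℝ] × ℍ[ℝ]} {f : ℍ[ℝ] → ℍ[ℝ]}

/-- The complex-valued component of a stem function along a real functional. -/
noncomputable def stemComponent (ℓ : ℍ[ℝ] →L[ℝ] ℝ) (F : ℂ → ℍ[ℝ] × ℍ[ℝ]) (z : ℂ) : ℂ :=
  (ℓ (F z).1 : ℂ) + (ℓ (F z).2 : ℂ) * Complex.I

theorem stemComponent_conj (hF : IsStemFunction D F) (ℓ : ℍ[ℝ] →L[ℝ] ℝ) :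
    ∀ z ∈ D, stemComponent ℓ F (starRingEnd ℂ z) = starRingEnd ℂ (stemComponent ℓ F z) := by
  intro z hz
  simp [stemComponent, hF z hz]

theorem stemComponent_eq_zero_iff (ℓ : ℍ[ℝ] →L[ℝ] ℝ) (z : ℂ) :
    stemComponent ℓ F z = 0 ↔ ℓ (F z).1 = 0 ∧ ℓ (F z).2 = 0 := by
  simp [stemComponent, Complex.ext_iff]

theorem differentiableOn_stemComponent (hF : IsHolomorphic D F) (ℓ : ℍ[ℝ] →L[ℝ] ℝ) :
    DifferentiableOn ℂ (stemComponent ℓ F) D := by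
  intro z hz
  apply DifferentiableAt.differentiableWithinAt
  obtain ⟨L, hL, hLI⟩ := hF z hz
  have h1 : HasFDerivAt (stemComponent ℓ F)
      (Complex.ofRealCLM.comp (ℓ.comp ((ContinuousLinearMap.fst ℝ ℍ[ℝ] ℍ[ℝ]).comp L)) +
        (Complex.I • Complex.ofRealCLM).comp
          (ℓ.comp ((ContinuousLinearMap.snd ℝ ℍ[ℝ] ℍ[ℝ]).comp L))) z := by
    have e : stemComponent ℓ F = fun z =>
        (Complex.ofRealCLM.comp (ℓ.comp (ContinuousLinearMap.fst ℝ ℍ[ℝ] ℍ[ℝ])) +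
        (Complex.I • Complex.ofRealCLM).comp
          (ℓ.comp (ContinuousLinearMap.snd ℝ ℍ[ℝ] ℍ[ℝ]))) (F z) := by
      funext z
      simp [stemComponent, mul_comm]
    rw [e]
    exact (ContinuousLinearMap.hasFDerivAt _).comp z hL
  rw [differentiableAt_complex_iff_differentiableAt_real]
  refine ⟨h1.differentiableAt, ?_⟩
  -- Complex linearity at the vector `1` is exactly the Cauchy–Riemann equation.
  have hI1 := hLI 1
  rw [mul_one] at hI1
  rw [h1.fderiv]
  simp only [add_apply, ContinuousLinearMap.comp_apply, hI1, mulSqrtNegOne]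
  simp [mul_add, ← mul_assoc]
  ring

theorem induces_sliceEmb (hF : Induces D F f) {I : ℍ[ℝ]} (hI : I ∈ imagUnits) {z : ℂ}
    (hz : z ∈ D) : f (sliceEmb hI z) = (F z).1 + I * (F z).2 := by
  rw [sliceEmb_apply]
  exact hF z.re z.im hz I hI

theorem exists_hasSphericalExpansion (hDo : IsOpen D) (hDs : ∀ z ∈ D, starRingEnd ℂ z ∈ D)
    (hst : IsStemFunction D F) (hol : IsHolomorphic D F) (hind : Induces D F f)
    {I₀ : ℍ[ℝ]} (hI₀ : I₀ ∈ imagUnits) {z₀ : ℂ} (hz₀ : z₀ ∈ D) (him : z₀.im ≠ 0) :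
    ∃ s, HasSphericalExpansion D f (sliceEmb hI₀ z₀) s := by
  obtain ⟨R, hR, hRi, hRD⟩ := exists_quadPoly_ball_subset hDo hDs hz₀ him
  let b := Module.finBasis ℝ ℍ[ℝ]
  let ℓ : Fin (Module.finrank ℝ ℍ[ℝ]) → ℍ[ℝ] →L[ℝ] ℝ := fun j =>
    LinearMap.toContinuousLinearMap (b.coord j)
  have hb : ∀ x : ℍ[ℝ], ∑ j, (ℓ j x : ℍ[ℝ]) * b j = x := fun x => by
    conv_rhs => rw [← b.sum_repr x]
    refine Finset.sum_congr rfl fun j _ => ?_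
    rw [Quaternion.coe_mul_eq_smul]; rfl
  choose e o heo using fun j => exists_scalar_expansion
    (differentiableOn_stemComponent hol (ℓ j)) (stemComponent_conj hst (ℓ j)) hR hRi hRD
  let A : ℕ → ℍ[ℝ] := fun n => ∑ j, (e j n : ℍ[ℝ]) * b j
  let B : ℕ → ℍ[ℝ] := fun n => ∑ j, (o j n : ℍ[ℝ]) * b j
  -- Recentring: `A + (x - Re q₀) B = [A + (q₀ - Re q₀) B] + (x - q₀) B`.
  let s : ℕ → ℍ[ℝ] := fun m => if m % 2 = 0 then
    A (m / 2) + (sliceEmb hI₀ z₀ - (z₀.re : ℍ[ℝ])) * B (m / 2) else B (m / 2)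
  have hs0 : ∀ n, s (2 * n) = A n + (sliceEmb hI₀ z₀ - (z₀.re : ℍ[ℝ])) * B n := fun n => by
    simp [s]
  have hs1 : ∀ n, s (2 * n + 1) = B n := fun n => by
    have h1 : (2 * n + 1) % 2 ≠ 0 := by omega
    have h2 : (2 * n + 1) / 2 = n := by omega
    simp only [s, h1, h2, if_false]
  refine ⟨s, R, hR, ?_, ?_⟩
  · intro x hx
    obtain ⟨I, hI, z, rfl⟩ := exists_sliceEmb_eq x
    rw [sliceEmb_mem_circularization hI hDs]
    apply hRD
    change ‖charPoly _ _‖ < _ at hx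
    rwa [charPoly_sliceEmb hI hI₀, norm_sliceEmb] at hx
  · intro x hx
    obtain ⟨I, hI, z, rfl⟩ := exists_sliceEmb_eq x
    change ‖charPoly _ _‖ < _ at hx
    rw [charPoly_sliceEmb hI hI₀, norm_sliceEmb] at hx
    have hz := hRD z hx
    have hval : f (sliceEmb hI z) = ∑ j, sliceEmb hI (stemComponent (ℓ j) F z) * b j := by
      have h1 : ∀ j, sliceEmb hI (stemComponent (ℓ j) F z) * b j =
          (ℓ j (F z).1 : ℍ[ℝ]) * b j + I * ((ℓ j (F z).2 : ℍ[ℝ]) * b j) := fun j => by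
        rw [sliceEmb_apply, ← mul_assoc, ← add_mul]
        simp [stemComponent]
      rw [induces_sliceEmb hind hI hz, Finset.sum_congr rfl fun j _ => h1 j,
        Finset.sum_add_distrib, ← Finset.mul_sum, hb, hb]
    rw [hval]
    have hsum := hasSum_sum (s := Finset.univ) fun j _ =>
      (((heo j z hx).map (sliceEmb hI) (continuous_sliceEmb hI)).mul_right (b j))
    have hterm : (fun n : ℕ => charPoly (sliceEmb hI₀ z₀) (sliceEmb hI z) ^ n *
        (s (2 * n) + (sliceEmb hI z - sliceEmb hI₀ z₀) * s (2 * n + 1))) = fun n =>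
        ∑ j, ((sliceEmb hI) ∘ fun n => quadPoly z₀ z ^ n *
          ((e j n : ℂ) + (z - z₀.re) * (o j n : ℂ))) n * b j := by
      funext n
      rw [charPoly_sliceEmb hI hI₀, hs0, hs1]
      simp only [Function.comp_apply, map_mul, map_pow, map_add, map_sub, sliceEmb_ofReal]
      have h2 : A n + (sliceEmb hI₀ z₀ - (z₀.re : ℍ[ℝ])) * B n +
          (sliceEmb hI z - sliceEmb hI₀ z₀) * B n =
          A n + (sliceEmb hI z - (z₀.re : ℍ[ℝ])) * B n := by
        noncomm_ring
      rw [h2]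
      simp only [A, B, Finset.mul_sum, ← Finset.sum_add_distrib]
      refine Finset.sum_congr rfl fun j _ => ?_
      noncomm_ring
    rw [hterm]
    exact hsum

/-- A spherical expansion restricted to the segment `Δ = t`, `t` real, gives power series
expansions in `t` of the two components of the stem function. -/
theorem HasSphericalExpansion.hasSum_stem (hDs : ∀ z ∈ D, starRingEnd ℂ z ∈ D)
    (hind : Induces D F f) {I₀ : ℍ[ℝ]} (hI₀ : I₀ ∈ imagUnits) {z₀ : ℂ} (him : z₀.im ≠ 0)
    {s : ℕ → ℍ[ℝ]} (hs : HasSphericalExpansion D f (sliceEmb hI₀ z₀) s) :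
    ∃ r : ℝ, 0 < r ∧ ∀ t : ℝ, |t| < r →
      0 < z₀.im ^ 2 - t ∧ (⟨z₀.re, √(z₀.im ^ 2 - t)⟩ : ℂ) ∈ D ∧
      HasSum (fun n => t ^ n • (s (2 * n) - (z₀.im : ℍ[ℝ]) * I₀ * s (2 * n + 1)))
        (F ⟨z₀.re, √(z₀.im ^ 2 - t)⟩).1 ∧
      HasSum (fun n => t ^ n • s (2 * n + 1))
        ((√(z₀.im ^ 2 - t))⁻¹ • (F ⟨z₀.re, √(z₀.im ^ 2 - t)⟩).2) := by
  obtain ⟨R, hR, hsub, hsum⟩ := hs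
  refine ⟨min (R ^ 2) (z₀.im ^ 2), lt_min (by positivity) (by positivity), fun t ht => ?_⟩
  obtain ⟨ht1, ht2⟩ := lt_min_iff.1 ht
  have hpos : 0 < z₀.im ^ 2 - t := by linarith [le_abs_self t]
  set y := √(z₀.im ^ 2 - t) with hy
  have hy0 : 0 < y := Real.sqrt_pos.2 hpos
  have hysq : y ^ 2 = z₀.im ^ 2 - t := Real.sq_sqrt hpos.le
  set z : ℂ := ⟨z₀.re, y⟩ with hz
  have hq : quadPoly z₀ z = (t : ℂ) := by
    have h1 : z - z₀.re = y * Complex.I := by apply Complex.ext <;> simp [hz]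
    rw [quadPoly, h1, mul_pow, Complex.I_sq, ← Complex.ofReal_pow, hysq]
    push_cast; ring
  have hchar : ∀ {I : ℍ[ℝ]} (hI : I ∈ imagUnits),
      charPoly (sliceEmb hI₀ z₀) (sliceEmb hI z) = (t : ℍ[ℝ]) := fun hI => by
    rw [charPoly_sliceEmb hI hI₀, hq, sliceEmb_ofReal]
  have hmem : ∀ {I : ℍ[ℝ]} (hI : I ∈ imagUnits),
      sliceEmb hI z ∈ cassiniBall (sliceEmb hI₀ z₀) R := fun hI => by
    change ‖charPoly _ _‖ < _
    rw [hchar hI, Quaternion.norm_coe]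
    exact ht1
  have hzD : z ∈ D := (sliceEmb_mem_circularization hI₀ hDs z).1 (hsub (hmem hI₀))
  -- At `x = α ± I₀y` one has `x - q₀ = (±y - β) I₀`. The half-sum of the expansions isolates `F₀`;
  -- the half-difference, multiplied by `-I₀ / y`, isolates `F₁ / y`.
  have hI₀' := neg_mem_imagUnits hI₀
  have hp := hsum _ (hmem hI₀)
  have hm := hsum _ (hmem hI₀')
  rw [hchar hI₀, induces_sliceEmb hind hI₀ hzD] at hp
  rw [hchar hI₀', induces_sliceEmb hind hI₀' hzD] at hm
  have hdp : sliceEmb hI₀ z - sliceEmb hI₀ z₀ = (y - z₀.im) • I₀ := by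
    simp only [sliceEmb_apply, hz, Quaternion.mul_coe_eq_smul, sub_smul]; abel
  have hdm : sliceEmb hI₀' z - sliceEmb hI₀ z₀ = (-y - z₀.im) • I₀ := by
    simp only [sliceEmb_apply, hz, Quaternion.mul_coe_eq_smul, sub_smul, neg_smul, smul_neg]
    abel
  have hpow : ∀ (n : ℕ) (q : ℍ[ℝ]), (t : ℍ[ℝ]) ^ n * q = t ^ n • q := fun n q => by
    rw [← Quaternion.coe_pow, Quaternion.coe_mul_eq_smul]
  simp only [hdp, hpow] at hp
  simp only [hdm, hpow] at hm
  refine ⟨hpos, hzD, ?_, ?_⟩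
  · have h := (hp.add hm).const_smul (2⁻¹ : ℝ)
    have hterm : (fun n => t ^ n • (s (2 * n) - (z₀.im : ℍ[ℝ]) * I₀ * s (2 * n + 1))) =
        fun n => (2⁻¹ : ℝ) • (t ^ n • (s (2 * n) + (y - z₀.im) • I₀ * s (2 * n + 1)) +
          t ^ n • (s (2 * n) + (-y - z₀.im) • I₀ * s (2 * n + 1))) := by
      funext n
      simp only [Quaternion.coe_mul_eq_smul, smul_mul_assoc]
      module
    have hval : (F z).1 = (2⁻¹ : ℝ) • ((F z).1 + I₀ * (F z).2 + ((F z).1 + -I₀ * (F z).2)) := by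
      simp only [neg_mul]
      module
    rw [hterm, hval]; exact h
  · have h := ((hp.sub hm).const_smul ((2 * y)⁻¹ : ℝ)).mul_left (-I₀)
    have hII : ∀ q : ℍ[ℝ], I₀ * (I₀ * q) = -q := fun q => by
      rw [← mul_assoc, imagUnits_mul_self hI₀, neg_one_mul]
    have hterm : (fun n => t ^ n • s (2 * n + 1)) =
        fun n => -I₀ * ((2 * y)⁻¹ • (t ^ n • (s (2 * n) + (y - z₀.im) • I₀ * s (2 * n + 1)) -
          t ^ n • (s (2 * n) + (-y - z₀.im) • I₀ * s (2 * n + 1)))) := by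
      funext n
      simp only [smul_mul_assoc, mul_smul_comm, mul_sub, mul_add, neg_mul, hII]
      match_scalars <;> field_simp <;> ring
    have hval : y⁻¹ • (F z).2 =
        -I₀ * ((2 * y)⁻¹ • ((F z).1 + I₀ * (F z).2 - ((F z).1 + -I₀ * (F z).2))) := by
      simp only [mul_smul_comm, mul_sub, mul_add, neg_mul, hII, mul_neg]
      match_scalars <;> field_simp <;> ring
    rw [hterm, hval]; exact h

theorem HasSphericalExpansion.unique (hDs : ∀ z ∈ D, starRingEnd ℂ z ∈ D)
    (hind : Induces D F f) {I₀ : ℍ[ℝ]} (hI₀ : I₀ ∈ imagUnits) {z₀ : ℂ} (him : z₀.im ≠ 0)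
    {s s' : ℕ → ℍ[ℝ]} (hs : HasSphericalExpansion D f (sliceEmb hI₀ z₀) s)
    (hs' : HasSphericalExpansion D f (sliceEmb hI₀ z₀) s') : s = s' := by
  obtain ⟨r, hr, h⟩ := hs.hasSum_stem hDs hind hI₀ him
  obtain ⟨r', hr', h'⟩ := hs'.hasSum_stem hDs hind hI₀ him
  have hmin := lt_min hr hr'
  have h1 := coeff_eq_zero_of_hasSum_zero hmin
    (c := fun n => s (2 * n + 1) - s' (2 * n + 1)) fun t ht => by
      obtain ⟨a, b⟩ := lt_min_iff.1 ht
      simpa only [smul_sub, sub_self] using (h t a).2.2.2.sub (h' t b).2.2.2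
  have h0 := coeff_eq_zero_of_hasSum_zero hmin
    (c := fun n => (s (2 * n) - (z₀.im : ℍ[ℝ]) * I₀ * s (2 * n + 1)) -
      (s' (2 * n) - (z₀.im : ℍ[ℝ]) * I₀ * s' (2 * n + 1))) fun t ht => by
      obtain ⟨a, b⟩ := lt_min_iff.1 ht
      have := (h t a).2.2.1.sub (h' t b).2.2.1
      rw [sub_self] at this
      convert this using 2 with n
      rw [← smul_sub]
  have hodd : ∀ n, s (2 * n + 1) = s' (2 * n + 1) := fun n => sub_eq_zero.1 (congrFun h1 n)
  have heven : ∀ n, s (2 * n) = s' (2 * n) := fun n => by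
    have := sub_eq_zero.1 (congrFun h0 n)
    rw [hodd n] at this
    exact sub_left_injective this
  funext m
  rcases Nat.even_or_odd' m with ⟨k, rfl | rfl⟩
  · exact heven k
  · exact hodd k

end SliceRegular

/-! ### The slice `ℂ_J` as a closed real subspace -/

namespace SliceRegular

variable {D : Set ℂ} {F : ℂ → ℍ[ℝ] × ℍ[ℝ]} {f : ℍ[ℝ] → ℍ[ℝ]}

/-- The commutator with `J`, whose kernel is the slice `ℂ_J`. -/
noncomputable def commutatorCLM (J : ℍ[ℝ]) : ℍ[ℝ] →L[ℝ] ℍ[ℝ] :=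
  (ContinuousLinearMap.mul ℝ ℍ[ℝ]).flip J - ContinuousLinearMap.mul ℝ ℍ[ℝ] J

theorem commutatorCLM_apply (J q : ℍ[ℝ]) : commutatorCLM J q = q * J - J * q := by
  simp [commutatorCLM]

theorem mem_slicePlane_iff_exists_sliceEmb {J : ℍ[ℝ]} (hJ : J ∈ imagUnits) (q : ℍ[ℝ]) :
    q ∈ slicePlane J ↔ ∃ z, q = sliceEmb hJ z := by
  constructor
  · rintro ⟨α, β, rfl⟩
    exact ⟨⟨α, β⟩, by rw [sliceEmb_apply, Quaternion.coe_commutes β J]⟩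
  · rintro ⟨z, rfl⟩
    exact ⟨z.re, z.im, by rw [sliceEmb_apply, Quaternion.coe_commutes z.im J]⟩

theorem mem_slicePlane_iff {J : ℍ[ℝ]} (hJ : J ∈ imagUnits) (q : ℍ[ℝ]) :
    q ∈ slicePlane J ↔ commutatorCLM J q = 0 := by
  rw [commutatorCLM_apply, sub_eq_zero]
  constructor
  · rintro ⟨α, β, rfl⟩
    rw [add_mul, mul_add, mul_assoc, Quaternion.coe_commutes α J, ← mul_assoc J,
      ← Quaternion.coe_commutes β J, mul_assoc]
  · intro h
    obtain ⟨h0, h1⟩ := imagUnits_components hJ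
    have ei := congrArg QuaternionAlgebra.imI h
    have ej := congrArg QuaternionAlgebra.imJ h
    have ek := congrArg QuaternionAlgebra.imK h
    simp [h0] at ei ej ek
    -- Commuting with `J` forces `q.im` to be parallel to `J`; the coefficient is their inner
    -- product, as `J` is a unit vector.
    refine ⟨q.re, q.imI * J.imI + q.imJ * J.imJ + q.imK * J.imK, ?_⟩
    ext
    · simp [h0]
    · simp
      linear_combination (-q.imI) * h1 + J.imJ / 2 * ek - J.imK / 2 * ej
    · simp
      linear_combination (-q.imJ) * h1 - J.imI / 2 * ek + J.imK / 2 * ei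
    · simp
      linear_combination (-q.imK) * h1 + J.imI / 2 * ej - J.imJ / 2 * ei

theorem mem_realLine_iff (q : ℍ[ℝ]) : q ∈ realLine ↔ ∀ J ∈ imagUnits, q ∈ slicePlane J := by
  constructor
  · rintro ⟨r, rfl⟩ J -
    exact ⟨r, 0, by simp⟩
  · intro h
    obtain ⟨I, hI, hI₁⟩ : ∃ I ∈ imagUnits, I.imI = 1 :=
      ⟨⟨0, 1, 0, 0⟩, mem_imagUnits_of_components rfl (by simp), rfl⟩
    obtain ⟨J, hJ, hJ₀⟩ : ∃ J ∈ imagUnits, J.imI = 0 :=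
      ⟨⟨0, 0, 1, 0⟩, mem_imagUnits_of_components rfl (by simp), rfl⟩
    obtain ⟨a, b, hi⟩ := h I hI
    obtain ⟨c, d, hj⟩ := h J hJ
    have h1 := congrArg QuaternionAlgebra.imI hi
    have h2 := congrArg QuaternionAlgebra.imI hj
    simp [hI₁] at h1
    simp [hJ₀] at h2
    have hb : b = 0 := h1.symm.trans h2
    exact ⟨a, by simp [hi, hb]⟩

theorem slicePlane_hasSum {J : ℍ[ℝ]} (hJ : J ∈ imagUnits) {u : ℕ → ℍ[ℝ]} {a : ℍ[ℝ]}
    (h : HasSum u a) (hu : ∀ n, u n ∈ slicePlane J) : a ∈ slicePlane J := by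
  rw [mem_slicePlane_iff hJ]
  have h1 := h.mapL (commutatorCLM J)
  simp only [fun n => (mem_slicePlane_iff hJ (u n)).1 (hu n)] at h1
  exact h1.unique hasSum_zero

theorem slicePlane_smul {J : ℍ[ℝ]} (hJ : J ∈ imagUnits) (r : ℝ) {q : ℍ[ℝ]}
    (hq : q ∈ slicePlane J) : r • q ∈ slicePlane J := by
  rw [mem_slicePlane_iff hJ] at *
  rw [map_smul, hq, smul_zero]

theorem slicePlane_add {J : ℍ[ℝ]} (hJ : J ∈ imagUnits) {p q : ℍ[ℝ]}
    (hp : p ∈ slicePlane J) (hq : q ∈ slicePlane J) : p + q ∈ slicePlane J := by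
  rw [mem_slicePlane_iff hJ] at *
  rw [map_add, hp, hq, add_zero]

theorem slicePlane_sub {J : ℍ[ℝ]} (hJ : J ∈ imagUnits) {p q : ℍ[ℝ]}
    (hp : p ∈ slicePlane J) (hq : q ∈ slicePlane J) : p - q ∈ slicePlane J := by
  rw [mem_slicePlane_iff hJ] at *
  rw [map_sub, hp, hq, sub_zero]

theorem slicePlane_ofReal_mul_self_mul {J : ℍ[ℝ]} (hJ : J ∈ imagUnits) (r : ℝ) {q : ℍ[ℝ]}
    (hq : q ∈ slicePlane J) : (r : ℍ[ℝ]) * J * q ∈ slicePlane J := by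
  rw [mul_assoc, Quaternion.coe_mul_eq_smul]
  apply slicePlane_smul hJ
  rw [mem_slicePlane_iff hJ, commutatorCLM_apply, sub_eq_zero] at *
  rw [mul_assoc, hq]

/-- The commutator with `J` kills the sum for every small `t`, hence kills every coefficient. -/
theorem coeff_mem_slicePlane {J : ℍ[ℝ]} (hJ : J ∈ imagUnits) {c : ℕ → ℍ[ℝ]} {a : ℝ → ℍ[ℝ]}
    {r : ℝ} (hr : 0 < r) (h : ∀ t : ℝ, |t| < r → HasSum (fun n => t ^ n • c n) (a t))
    (ha : ∀ t : ℝ, |t| < r → a t ∈ slicePlane J) (n : ℕ) : c n ∈ slicePlane J := by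
  rw [mem_slicePlane_iff hJ]
  have := coeff_eq_zero_of_hasSum_zero hr (c := fun n => commutatorCLM J (c n)) fun t ht => by
    have h1 := (h t ht).mapL (commutatorCLM J)
    simpa only [map_smul, (mem_slicePlane_iff hJ _).1 (ha t ht)] using h1
  exact congrFun this n

/-! ### Preserving properties read on the stem function -/

theorem Induces.eqOn {F' : ℂ → ℍ[ℝ] × ℍ[ℝ]} (h : Induces D F f) (h' : Induces D F' f)
    {z : ℂ} (hz : z ∈ D) : F z = F' z := by
  obtain ⟨I, hI⟩ := imagUnits_nonempty
  have hI' := neg_mem_imagUnits hI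
  have hp := (induces_sliceEmb h hI hz).symm.trans (induces_sliceEmb h' hI hz)
  have hm := (induces_sliceEmb h hI' hz).symm.trans (induces_sliceEmb h' hI' hz)
  have h1 : (F z).1 = (F' z).1 := by
    have := congrArg₂ (fun a b => (2⁻¹ : ℝ) • (a + b)) hp hm
    simp only [neg_mul] at this
    convert this using 1 <;> module
  have h2 : (F z).2 = (F' z).2 := by
    rw [h1, add_right_inj] at hp
    have := congrArg (fun a => -I * a) hp
    simpa only [neg_mul, ← mul_assoc, imagUnits_mul_self hI, neg_neg, one_mul] using this
  exact Prod.ext h1 h2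

/-- The inducing stem function is unique on `D`, so the existential in the definition can be tested
on the holomorphic one. -/
theorem isOneSlicePreserving_iff (hst : IsStemFunction D F) (hind : Induces D F f) (J : ℍ[ℝ]) :
    IsOneSlicePreserving D J f ↔
      ∀ z ∈ D, (F z).1 ∈ slicePlane J ∧ (F z).2 ∈ slicePlane J := by
  constructor
  · rintro ⟨F', -, hind', h⟩ z hz
    rw [hind.eqOn hind' hz]
    exact h z hz
  · exact fun h => ⟨F, hst, hind, h⟩

theorem isSlicePreserving_iff (hst : IsStemFunction D F) (hind : Induces D F f) :
    IsSlicePreserving D f ↔ ∀ J ∈ imagUnits, IsOneSlicePreserving D J f := by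
  constructor
  · rintro ⟨F', hst', hind', h⟩ J hJ
    exact ⟨F', hst', hind', fun z hz =>
      ⟨(mem_realLine_iff _).1 (h z hz).1 J hJ, (mem_realLine_iff _).1 (h z hz).2 J hJ⟩⟩
  · intro h
    refine ⟨F, hst, hind, fun z hz => ⟨?_, ?_⟩⟩ <;> rw [mem_realLine_iff] <;> intro J hJ
    · exact ((isOneSlicePreserving_iff hst hind J).1 (h J hJ) z hz).1
    · exact ((isOneSlicePreserving_iff hst hind J).1 (h J hJ) z hz).2

theorem mem_circularization_diff_realLine (hDs : ∀ z ∈ D, starRingEnd ℂ z ∈ D) {I : ℍ[ℝ]}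
    (hI : I ∈ imagUnits) {z : ℂ} :
    sliceEmb hI z ∈ circularization D \ realLine ↔ z ∈ D ∧ z.im ≠ 0 := by
  rw [Set.mem_sdiff, sliceEmb_mem_circularization hI hDs]
  refine and_congr_right fun _ => not_congr ⟨?_, fun h => ⟨z.re, ?_⟩⟩
  · rintro ⟨r, hr⟩
    have h1 : sliceEmb hI (r : ℂ) = sliceEmb hI z := by rw [sliceEmb_ofReal]; exact hr
    have h2 : (r : ℂ) = z := (sliceEmb hI).toRingHom.injective h1
    rw [← h2]; simp
  · rw [sliceEmb_apply, h]; simp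

/-- Real points carry no spherical coefficients; they are reached vertically, by continuity of `F`
and closedness of `ℂ_J`. -/
theorem forall_mem_slicePlane_of_im_ne_zero (hDo : IsOpen D) (hol : IsHolomorphic D F)
    {J : ℍ[ℝ]} (hJ : J ∈ imagUnits)
    (h : ∀ z ∈ D, z.im ≠ 0 → (F z).1 ∈ slicePlane J ∧ (F z).2 ∈ slicePlane J) :
    ∀ z ∈ D, (F z).1 ∈ slicePlane J ∧ (F z).2 ∈ slicePlane J := by
  intro z hz
  by_cases him : z.im = 0
  · obtain ⟨L, hL, -⟩ := hol z hz
    have hF := hL.continuousAt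
    have hc : Continuous fun t : ℝ => z + (t : ℂ) * Complex.I := by fun_prop
    have hpath : Filter.Tendsto (fun t : ℝ => z + (t : ℂ) * Complex.I)
        (nhdsWithin 0 {0}ᶜ) (nhds z) := by
      have := hc.tendsto 0
      simp only [Complex.ofReal_zero, zero_mul, add_zero] at this
      exact this.mono_left nhdsWithin_le_nhds
    have hev : ∀ᶠ t : ℝ in nhdsWithin 0 {0}ᶜ,
        (F (z + t * Complex.I)).1 ∈ slicePlane J ∧ (F (z + t * Complex.I)).2 ∈ slicePlane J := by
      filter_upwards [hpath.eventually (hDo.mem_nhds hz), self_mem_nhdsWithin] with t ht ht0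
      exact h _ ht (by simpa [him] using ht0)
    have hclosed : IsClosed (slicePlane J) := by
      have : slicePlane J = commutatorCLM J ⁻¹' {0} := by
        ext q; exact mem_slicePlane_iff hJ q
      rw [this]
      exact isClosed_singleton.preimage (commutatorCLM J).continuous
    have hFt := hF.tendsto.comp hpath
    exact ⟨hclosed.mem_of_tendsto ((continuous_fst.tendsto _).comp hFt) (hev.mono fun _ h => h.1),
      hclosed.mem_of_tendsto ((continuous_snd.tendsto _).comp hFt) (hev.mono fun _ h => h.2)⟩
  · exact h z hz him

theorem stem_mem_slicePlane_conj (hst : IsStemFunction D F) {J : ℍ[ℝ]} (hJ : J ∈ imagUnits)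
    {z : ℂ} (hz : z ∈ D) (h : (F ⟨z.re, |z.im|⟩).1 ∈ slicePlane J ∧
      (F ⟨z.re, |z.im|⟩).2 ∈ slicePlane J) : (F z).1 ∈ slicePlane J ∧ (F z).2 ∈ slicePlane J := by
  rcases abs_cases z.im with h0 | h0
  · rwa [h0.1] at h
  · have e : (⟨z.re, |z.im|⟩ : ℂ) = starRingEnd ℂ z := by
      apply Complex.ext <;> simp [h0.1]
    rw [e, hst z hz] at h
    refine ⟨h.1, ?_⟩
    have := slicePlane_smul hJ (-1) h.2
    simpa using this

/-! ### Transfer between coefficients and stem values -/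

theorem HasSphericalExpansion.coeff_mem_slicePlane (hDs : ∀ z ∈ D, starRingEnd ℂ z ∈ D)
    (hind : Induces D F f) {J : ℍ[ℝ]} (hJ : J ∈ imagUnits)
    (h : ∀ z ∈ D, (F z).1 ∈ slicePlane J ∧ (F z).2 ∈ slicePlane J)
    {I₀ : ℍ[ℝ]} (hI₀ : I₀ ∈ imagUnits) {z₀ : ℂ} (him : z₀.im ≠ 0)
    {s : ℕ → ℍ[ℝ]} (hs : HasSphericalExpansion D f (sliceEmb hI₀ z₀) s) (n : ℕ) :
    s (2 * n + 1) ∈ slicePlane J ∧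
      s (2 * n) - (z₀.im : ℍ[ℝ]) * I₀ * s (2 * n + 1) ∈ slicePlane J := by
  obtain ⟨r, hr, hsum⟩ := hs.hasSum_stem hDs hind hI₀ him
  exact ⟨SliceRegular.coeff_mem_slicePlane hJ hr (fun t ht => (hsum t ht).2.2.2)
      (fun t ht => slicePlane_smul hJ _ (h _ (hsum t ht).2.1).2) n,
    SliceRegular.coeff_mem_slicePlane hJ hr
      (c := fun n => s (2 * n) - (z₀.im : ℍ[ℝ]) * I₀ * s (2 * n + 1))
      (fun t ht => (hsum t ht).2.2.1) (fun t ht => (h _ (hsum t ht).2.1).1) n⟩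

/-- The zeroth-order part of the expansion recovers the stem function at the centre. -/
theorem HasSphericalExpansion.stem_mem_slicePlane (hDs : ∀ z ∈ D, starRingEnd ℂ z ∈ D)
    (hst : IsStemFunction D F) (hind : Induces D F f) {J : ℍ[ℝ]} (hJ : J ∈ imagUnits)
    {z₀ : ℂ} (hz₀ : z₀ ∈ D) (him : z₀.im ≠ 0)
    {s : ℕ → ℍ[ℝ]} (hs : HasSphericalExpansion D f (sliceEmb hJ z₀) s)
    (h0 : s 0 ∈ slicePlane J) (h1 : s 1 ∈ slicePlane J) :
    (F z₀).1 ∈ slicePlane J ∧ (F z₀).2 ∈ slicePlane J := by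
  obtain ⟨r, hr, hsum⟩ := hs.hasSum_stem hDs hind hJ him
  obtain ⟨-, -, ha, hb⟩ := hsum 0 (by simpa using hr)
  apply stem_mem_slicePlane_conj hst hJ hz₀
  simp only [sub_zero, Real.sqrt_sq_eq_abs] at ha hb
  constructor
  · have := ha.unique (hasSum_single 0 fun n hn => by simp [hn])
    rw [this]
    simpa using slicePlane_sub hJ h0 (slicePlane_ofReal_mul_self_mul hJ _ h1)
  · have := hb.unique (hasSum_single 0 fun n hn => by simp [hn])
    rw [inv_smul_eq_iff₀ (abs_ne_zero.2 him)] at this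
    rw [this]
    simpa using slicePlane_smul hJ |z₀.im| h1

/-- The series put `F` in `ℂ_J` along a vertical segment through `Re z₀ + i|Im z₀|`, a set
accumulating there, so the identity theorem applies. -/
theorem HasSphericalExpansion.forall_stem_mem_slicePlane (hDo : IsOpen D)
    (hDs : ∀ z ∈ D, starRingEnd ℂ z ∈ D) (hconn : IsPreconnected (circularization D))
    (hst : IsStemFunction D F) (hol : IsHolomorphic D F) (hind : Induces D F f)
    {J : ℍ[ℝ]} (hJ : J ∈ imagUnits) {z₀ : ℂ} (hz₀ : z₀ ∈ D) (him : z₀.im ≠ 0)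
    {s : ℕ → ℍ[ℝ]} (hs : HasSphericalExpansion D f (sliceEmb hJ z₀) s)
    (hmem : ∀ n, s n ∈ slicePlane J) :
    ∀ z ∈ D, (F z).1 ∈ slicePlane J ∧ (F z).2 ∈ slicePlane J := by
  obtain ⟨r, hr, hsum⟩ := hs.hasSum_stem hDs hind hJ him
  have hseg : ∀ t : ℝ, |t| < r →
      (F ⟨z₀.re, √(z₀.im ^ 2 - t)⟩).1 ∈ slicePlane J ∧
      (F ⟨z₀.re, √(z₀.im ^ 2 - t)⟩).2 ∈ slicePlane J := by
    intro t ht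
    obtain ⟨hpos, -, ha, hb⟩ := hsum t ht
    refine ⟨slicePlane_hasSum hJ ha fun n => slicePlane_smul hJ _ (slicePlane_sub hJ (hmem _)
      (slicePlane_ofReal_mul_self_mul hJ _ (hmem _))), ?_⟩
    have h1 := slicePlane_smul hJ √(z₀.im ^ 2 - t)
      (slicePlane_hasSum hJ hb fun n => slicePlane_smul hJ _ (hmem _))
    rwa [smul_inv_smul₀ (Real.sqrt_pos.2 hpos).ne'] at h1
  have htend : Filter.Tendsto (fun t : ℝ => (⟨z₀.re, √(z₀.im ^ 2 - t)⟩ : ℂ))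
      (nhdsWithin 0 {0}ᶜ) (nhdsWithin ⟨z₀.re, |z₀.im|⟩ {⟨z₀.re, |z₀.im|⟩}ᶜ) := by
    refine tendsto_nhdsWithin_iff.2 ⟨?_, ?_⟩
    · have hc : Continuous fun t : ℝ => (⟨z₀.re, √(z₀.im ^ 2 - t)⟩ : ℂ) := by
        have : (fun t : ℝ => (⟨z₀.re, √(z₀.im ^ 2 - t)⟩ : ℂ)) =
            fun t : ℝ => (z₀.re : ℂ) + ((√(z₀.im ^ 2 - t) : ℝ) : ℂ) * Complex.I := by
          funext t; apply Complex.ext <;> simp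
        rw [this]; fun_prop
      have := hc.tendsto 0
      simp only [sub_zero, Real.sqrt_sq_eq_abs] at this
      exact this.mono_left nhdsWithin_le_nhds
    · filter_upwards [self_mem_nhdsWithin,
        nhdsWithin_le_nhds (Metric.ball_mem_nhds (0 : ℝ) hr)] with t ht0 ht heq
      have h1 : √(z₀.im ^ 2 - t) = |z₀.im| := congrArg Complex.im heq
      have h2 := Real.sq_sqrt (hsum t (by simpa using ht)).1.le
      rw [h1, sq_abs] at h2
      exact ht0 (show t = 0 by linarith)
  -- Functionals composed with the commutator turn membership in `ℂ_J` into vanishing of scalar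
  -- holomorphic functions; the dual separates points.
  have hzero : ∀ ℓ : ℍ[ℝ] →L[ℝ] ℝ, ∀ z ∈ D,
      stemComponent (ℓ.comp (commutatorCLM J)) F z = 0 := by
    intro ℓ
    refine eqOn_zero_of_isPreconnected_circularization hDo hDs hconn
      (differentiableOn_stemComponent hol _) (stemComponent_conj hst _)
      ((mem_or_conj_mem hDs z₀).2 hz₀) (abs_nonneg _) (htend.frequently ?_)
    apply Filter.Eventually.frequently
    filter_upwards [nhdsWithin_le_nhds (Metric.ball_mem_nhds (0 : ℝ) hr)] with t ht
    obtain ⟨h1, h2⟩ := hseg t (by simpa using ht)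
    rw [mem_slicePlane_iff hJ] at h1 h2
    rw [stemComponent_eq_zero_iff]
    simp [h1, h2]
  intro z hz
  rw [mem_slicePlane_iff hJ, mem_slicePlane_iff hJ]
  constructor <;> refine SeparatingDual.eq_zero_of_forall_dual_eq_zero (R := ℝ) fun ℓ => ?_
  · exact ((stemComponent_eq_zero_iff _ _).1 (hzero ℓ z hz)).1
  · exact ((stemComponent_eq_zero_iff _ _).1 (hzero ℓ z hz)).2

/-! ### The coefficient criteria -/

theorem sphericalCoeff_spec {q₀ : ℍ[ℝ]} (h : ∃ s, HasSphericalExpansion D f q₀ s) :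
    HasSphericalExpansion D f q₀ (sphericalCoeff D f q₀) := by
  rw [sphericalCoeff, dif_pos h]
  exact h.choose_spec

theorem existsUnique_hasSphericalExpansion (hDo : IsOpen D)
    (hDs : ∀ z ∈ D, starRingEnd ℂ z ∈ D) (hf : IsSliceRegular D f) {q₀ : ℍ[ℝ]}
    (hq₀ : q₀ ∈ circularization D \ realLine) : ∃! s, HasSphericalExpansion D f q₀ s := by
  obtain ⟨F, hst, hol, hind⟩ := hf
  obtain ⟨I, hI, z, rfl⟩ := exists_sliceEmb_eq q₀
  obtain ⟨hz, him⟩ := (mem_circularization_diff_realLine hDs hI).1 hq₀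
  obtain ⟨s, hs⟩ := exists_hasSphericalExpansion hDo hDs hst hol hind hI hz him
  exact ⟨s, hs, fun s' hs' => hs'.unique hDs hind hI him hs⟩

theorem isOneSlicePreserving_iff_sphericalCoeff (hDo : IsOpen D)
    (hDs : ∀ z ∈ D, starRingEnd ℂ z ∈ D) (hf : IsSliceRegular D f) {J : ℍ[ℝ]}
    (hJ : J ∈ imagUnits) :
    IsOneSlicePreserving D J f ↔
      ∀ q₀ ∈ circularization D \ realLine, ∀ k : ℕ,
        sphericalCoeff D f q₀ (2 * k + 1) ∈ slicePlane J ∧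
        (q₀ ∈ slicePlane J → sphericalCoeff D f q₀ (2 * k) ∈ slicePlane J) := by
  have hspec := fun q₀ hq₀ =>
    sphericalCoeff_spec (existsUnique_hasSphericalExpansion hDo hDs hf (q₀ := q₀) hq₀).exists
  obtain ⟨F, hst, hol, hind⟩ := hf
  rw [isOneSlicePreserving_iff hst hind J]
  constructor
  · intro h q₀ hq₀ k
    have hs := hspec q₀ hq₀
    constructor
    · obtain ⟨I, hI, z, rfl⟩ := exists_sliceEmb_eq q₀
      obtain ⟨hz, him⟩ := (mem_circularization_diff_realLine hDs hI).1 hq₀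
      exact (hs.coeff_mem_slicePlane hDs hind hJ h hI him k).1
    · intro hq
      obtain ⟨z, rfl⟩ := (mem_slicePlane_iff_exists_sliceEmb hJ q₀).1 hq
      obtain ⟨hz, him⟩ := (mem_circularization_diff_realLine hDs hJ).1 hq₀
      obtain ⟨h1, h2⟩ := hs.coeff_mem_slicePlane hDs hind hJ h hJ him k
      -- The centre is in `ℂ_J`, so the correction `β J s₂ₖ₊₁` stays in `ℂ_J` and can be added back
      -- to recover `s₂ₖ`.
      simpa using slicePlane_add hJ h2 (slicePlane_ofReal_mul_self_mul hJ z.im h1)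
  · intro h
    refine forall_mem_slicePlane_of_im_ne_zero hDo hol hJ fun z hz him => ?_
    have hq := (mem_circularization_diff_realLine hDs hJ).2 ⟨hz, him⟩
    obtain ⟨h1, h2⟩ := h _ hq 0
    exact (hspec _ hq).stem_mem_slicePlane hDs hst hind hJ hz him
      (h2 ((mem_slicePlane_iff_exists_sliceEmb hJ _).2 ⟨z, rfl⟩)) h1

end SliceRegular

theorem corollary4p2 (D : Set ℂ) (hDo : IsOpen D) (hDs : ∀ z ∈ D, starRingEnd ℂ z ∈ D)
    (f : ℍ[ℝ] → ℍ[ℝ]) (hf : IsSliceRegular D f) :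
    -- the spherical coefficients exist and are unique
    (∀ q₀ ∈ circularization D \ realLine, ∃! s : ℕ → ℍ[ℝ], HasSphericalExpansion D f q₀ s) ∧
    -- slice preserving functions
    (IsSlicePreserving D f ↔
      ∀ q₀ ∈ circularization D \ realLine, ∀ k : ℕ,
        sphericalCoeff D f q₀ (2 * k + 1) ∈ realLine ∧
        ∀ I ∈ imagUnits, q₀ ∈ slicePlane I → sphericalCoeff D f q₀ (2 * k) ∈ slicePlane I) ∧
    -- one-slice preserving functions
    (∀ J ∈ imagUnits,
      (IsOneSlicePreserving D J f ↔
        ∀ q₀ ∈ circularization D \ realLine, ∀ k : ℕ,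
          sphericalCoeff D f q₀ (2 * k + 1) ∈ slicePlane J ∧
          (q₀ ∈ slicePlane J → sphericalCoeff D f q₀ (2 * k) ∈ slicePlane J))) ∧
    -- one-slice preserving functions, tested at a single point of the slice
    (IsConnected (circularization D) → ∀ J ∈ imagUnits,
      ∀ q₀ ∈ circularization D \ realLine, q₀ ∈ slicePlane J →
        (IsOneSlicePreserving D J f ↔ ∀ n : ℕ, sphericalCoeff D f q₀ n ∈ slicePlane J)) := by
  have hone := fun J (hJ : J ∈ imagUnits) =>
    isOneSlicePreserving_iff_sphericalCoeff hDo hDs hf hJ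
  refine ⟨fun q₀ hq₀ => existsUnique_hasSphericalExpansion hDo hDs hf hq₀, ?_, hone, ?_⟩
  · obtain ⟨F, hst, hol, hind⟩ := hf
    rw [isSlicePreserving_iff hst hind]
    constructor
    · intro h q₀ hq₀ k
      exact ⟨(mem_realLine_iff _).2 fun J hJ => ((hone J hJ).1 (h J hJ) q₀ hq₀ k).1,
        fun I hI => ((hone I hI).1 (h I hI) q₀ hq₀ k).2⟩
    · intro h J hJ
      exact (hone J hJ).2 fun q₀ hq₀ k =>
        ⟨(mem_realLine_iff _).1 (h q₀ hq₀ k).1 J hJ, (h q₀ hq₀ k).2 J hJ⟩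
  · intro hconn J hJ q₀ hq₀ hqJ
    constructor
    · intro h n
      have h1 := (hone J hJ).1 h q₀ hq₀
      rcases Nat.even_or_odd' n with ⟨k, rfl | rfl⟩
      · exact (h1 k).2 hqJ
      · exact (h1 k).1
    · intro h
      have hs := sphericalCoeff_spec (existsUnique_hasSphericalExpansion hDo hDs hf hq₀).exists
      obtain ⟨F, hst, hol, hind⟩ := hf
      obtain ⟨z, rfl⟩ := (mem_slicePlane_iff_exists_sliceEmb hJ q₀).1 hqJ
      obtain ⟨hz, him⟩ := (mem_circularization_diff_realLine hDs hJ).1 hq₀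
      exact (isOneSlicePreserving_iff hst hind J).2 (hs.forall_stem_mem_slicePlane hDo hDs
        hconn.isPreconnected hst hol hind hJ hz him h)
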